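/- In the Random Majority Model (RMM) on a finite graph $G=(V,E)$, every node is blue or white, and in each round all nodes simultaneously update their colors: a node takes the color held by the majority of its neighbors, and in case of a tie it chooses blue or white with probability $1/2$ each, independently of all other choices. This is a Markov chain on the $2^{|V|}$ colorings. Draw an edge from a coloring $s$ to a coloring $s'$ whenever the transition from $s$ to $s'$ has non-zero probability. An absorbing component is a maximal strongly connected component of this directed graph with no outgoing edge. The stabilization time of RMM on $G$ from an initial coloring $\mathcal{C}_0$ is the expected number of rounds until the process started at $\mathcal{C}_0$ reaches an absorbing component. **Theorem.** The stabilization time of RMM on the cycle $C_n$ is in $\mathcal{O}(n^2)$: there is a constant $C$ such that for every $n\ge 3$ and every initial coloring of $C_n$, the stabilization time of RMM on $C_n$ is at most $Cn^2$. The bound is tight. Let $l=n-5$ for even $n$ and $l=n-4$ for odd $n$, and let $l'$ be the odd integer closest to $l/2$. There is a constant $c>0$ such that for all sufficiently large $n$, RMM on $C_n$ has stabilization time at least $cn^2$ from every initial coloring in which some path of $l'$ consecutive nodes is colored alternately white, blue, white, $\dots$, white and the remaining $n-l'$ nodes are blue. -/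

import Mathlib

open MeasureTheory
open scoped ENNReal NNReal

namespace RMM

section Model

/-- A coloring of the node set: `true` stands for blue and `false` for white. -/
abbrev Coloring (V : Type*) := V → Bool

variable {V : Type*} [Fintype V] (G : SimpleGraph V) [DecidableRel G.Adj]

/-- The number of neighbors of `v` that have color `a` in the coloring `c`. -/
def nbrCount (c : Coloring V) (a : Bool) (v : V) : ℕ :=
  (Finset.univ.filter fun u => G.Adj v u ∧ c u = a).card

/-- One round of the Random Majority Model: every node takes the most frequent color in its
neighborhood, and in case of a tie it takes the color `r v` of its own coin. -/
def update (c : Coloring V) (r : V → Bool) : Coloring V := fun v =>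
  if nbrCount G c true v = nbrCount G c false v then r v
  else decide (nbrCount G c false v < nbrCount G c true v)

/-- A fair coin. -/
noncomputable def coin : Measure Bool := (PMF.uniformOfFintype Bool).toMeasure

instance : IsProbabilityMeasure coin :=
  inferInstanceAs (IsProbabilityMeasure (PMF.uniformOfFintype Bool).toMeasure)

/-- The coins of a single round: independent fair coins, one for every node. -/
noncomputable def roundCoins (V : Type*) [Fintype V] : Measure (V → Bool) :=
  Measure.pi fun _ => coin

instance : IsProbabilityMeasure (roundCoins V) :=
  inferInstanceAs (IsProbabilityMeasure (Measure.pi fun _ : V => coin))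

/-- The coins of all rounds: independent fair coins, one for every round and every node. -/
noncomputable def coins (V : Type*) [Fintype V] : Measure (ℕ → V → Bool) :=
  Measure.infinitePi fun _ => roundCoins V

/-- The process: `process G c₀ ω t` is the coloring in round `t` from the initial coloring `c₀`,
where `ω t v` is the coin of the node `v` in round `t + 1`. -/
def process (c₀ : Coloring V) (ω : ℕ → V → Bool) : ℕ → Coloring V
  | 0 => c₀
  | t + 1 => update G (process c₀ ω t) (ω t)

/-- The probability of the transition from `s` to `s'` in one round. -/
noncomputable def transProb (s s' : Coloring V) : ℝ≥0∞ :=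
  roundCoins V {r | update G s r = s'}

/-- The directed graph of the Markov chain: there is an edge from `s` to `s'` if the probability
to go from `s` to `s'` is non-zero. -/
def Edge (s s' : Coloring V) : Prop := transProb G s s' ≠ 0

/-- There is a directed path, possibly of length zero, from `s` to `s'`. -/
def Reachable (s s' : Coloring V) : Prop := Relation.ReflTransGen (Edge G) s s'

/-- The maximal strongly connected component of `s`. -/
def component (s : Coloring V) : Set (Coloring V) :=
  {s' | Reachable G s s' ∧ Reachable G s' s}

/-- An absorbing component: a maximal strongly connected component with no outgoing edge. -/
def IsAbsorbingComponent (S : Set (Coloring V)) : Prop :=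
  (∃ s, S = component G s) ∧ ∀ s ∈ S, ∀ s', Edge G s s' → s' ∈ S

/-- The first round in which the process is in an absorbing component (`∞` if there is none). -/
noncomputable def absorptionTime (c₀ : Coloring V) (ω : ℕ → V → Bool) : ℝ≥0∞ :=
  ⨅ (t : ℕ) (_ : ∃ S, IsAbsorbingComponent G S ∧ process G c₀ ω t ∈ S), (t : ℝ≥0∞)

/-- The stabilization time from the initial coloring `c₀`: the expected number of rounds that the
process needs to reach an absorbing component. -/
noncomputable def stabilizationTime (c₀ : Coloring V) : ℝ≥0∞ :=
  ∫⁻ ω, absorptionTime G c₀ ω ∂(coins V)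

end Model

/-- The `k`-alternating coloring (`k` odd, `k ≤ n`) of the `n`-cycle whose alternating path starts
at `s`: the nodes `s, s + 1, …, s + (k - 1)` are white, blue, white, …, white, and the other `n - k`
nodes are blue. -/
def alternatingColoring (n k : ℕ) (s : Fin n) : Coloring (Fin n) := fun v =>
  !decide ((v - s).val < k ∧ Even (v - s).val)

/-- The odd number `l`, equal to `n - 5` for even `n` and to `n - 4` for odd `n` (for `n ≥ 5`). -/
def maxLength (n : ℕ) : ℕ := if Even n then n - 5 else n - 4

/-- The odd integer closest to `l / 2`, for `l` as above. -/
def halfLength (n : ℕ) : ℕ := 2 * (maxLength n / 4) + 1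

theorem halfLength_spec {n : ℕ} (hn : 6 ≤ n) :
    Odd (halfLength n) ∧
      (2 * halfLength n = maxLength n + 1 ∨ 2 * halfLength n + 1 = maxLength n) := by
  refine ⟨⟨_, rfl⟩, ?_⟩
  unfold halfLength maxLength
  split_ifs with h
  · obtain ⟨m, hm⟩ := h
    omega
  · obtain ⟨m, hm⟩ := Nat.not_even_iff_odd.mp h
    omega

end RMM

/-!
On a cycle a round replaces the color of `v` by the common color of `v - 1` and `v + 1`, or by a coin
if these differ (a tie). In either case the mean of the new color is the average of the two
neighboring colors. Hence the number `W` of white nodes is a martingale, and since distinct nodes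
use independent coins, its conditional variance in a round is a quarter of the number of ties:
`E[(W' - a) ^ 2] = (W - a) ^ 2 + ties / 4` for every `a` (`integral_sq_whites_update`).

A coloring lies in an absorbing component if and only if it has no ties
(`isAbsorbed_of_ties_eq_zero` and `IsAbsorbed.ties_eq_zero`). For the upper bound, every round
before absorption therefore adds at least `1 / 4` to the mean of `W ^ 2`, which never exceeds
`n ^ 2`; so the expected number of these rounds is at most `4 * n ^ 2`.

For the lower bound, the number of ties never increases (`ties_update_le`), because ties move like
annihilating random walks. The given alternating colorings have at most two ties and `a` white nodes
with `n / 8 ≤ a ≤ n / 4`. So `E[(W - a) ^ 2] ≤ t / 2` after `t` rounds, while absorption requires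
`W = 0` or `W ≥ n / 2` (`whites_eq_zero_or_of_ties_eq_zero`), both at distance at least `a` from
`a`. By Chebyshev's inequality the process is not absorbed after `a ^ 2` rounds with probability at
least `1 / 2`, and the stabilization time is at least `a ^ 2 / 2`.
-/

namespace RMM

/-! ### Ties and white nodes on the cycle -/

section Cycle

variable {m : ℕ}

/-- The local form of the dynamics on a cycle of length `m + 3`: a node whose two neighbors agree
copies them, and any other node takes the color of its coin. -/
theorem update_cycleGraph (c : Coloring (Fin (m + 3))) (r : Fin (m + 3) → Bool) (v : Fin (m + 3)) :
    update (SimpleGraph.cycleGraph (m + 3)) c r v =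
      if c (v - 1) = c (v + 1) then c (v + 1) else r v := by
  have hne : v - 1 ≠ v + 1 := by
    intro h
    have h2 : (1 : Fin (m + 3)) + 1 = 0 := by
      have : v + 1 - (v - 1) = 0 := by rw [h]; simp
      rw [← this]; abel
    have := congrArg Fin.val h2
    simp [Fin.val_add] at this
    rw [Nat.mod_eq_of_lt (by omega)] at this
    omega
  have hadj : ∀ u, (SimpleGraph.cycleGraph (m + 3)).Adj v u ↔ u = v - 1 ∨ u = v + 1 := by
    intro u
    rw [SimpleGraph.cycleGraph_adj]
    refine or_congr ⟨fun h => ?_, fun h => ?_⟩ ⟨fun h => ?_, fun h => ?_⟩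
    · rw [← h]; abel
    · rw [h]; abel
    · rw [← h]; abel
    · rw [h]; abel
  have hcount : ∀ a, nbrCount (SimpleGraph.cycleGraph (m + 3)) c a v =
      (if c (v - 1) = a then 1 else 0) + (if c (v + 1) = a then 1 else 0) := by
    intro a
    have : (Finset.univ.filter fun u => (SimpleGraph.cycleGraph (m + 3)).Adj v u ∧ c u = a) =
        ({v - 1, v + 1} : Finset _).filter (fun u => c u = a) := by
      ext u
      simp [hadj]
    rw [nbrCount, this, Finset.card_filter, Finset.sum_pair hne]
  unfold update
  rw [hcount, hcount]
  cases c (v - 1) <;> cases c (v + 1) <;> simp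

/-- The number of ties of a coloring of the cycle: of the nodes whose two neighbors have different
colors. -/
def ties (c : Coloring (Fin (m + 3))) : ℕ :=
  (Finset.univ.filter fun v => c (v - 1) ≠ c (v + 1)).card

/-- The number of white nodes of a coloring, as a real number. -/
def whites (c : Coloring (Fin (m + 3))) : ℝ := ∑ v, if c v then 0 else 1

theorem ties_eq_zero_iff {c : Coloring (Fin (m + 3))} :
    ties c = 0 ↔ ∀ v, c (v - 1) = c (v + 1) := by
  simp [ties, Finset.filter_eq_empty_iff]

theorem whites_nonneg (c : Coloring (Fin (m + 3))) : 0 ≤ whites c :=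
  Finset.sum_nonneg fun v _ => by split_ifs <;> norm_num

theorem whites_le (c : Coloring (Fin (m + 3))) : whites c ≤ (m + 3 : ℕ) := by
  calc whites c ≤ ∑ _v : Fin (m + 3), (1 : ℝ) :=
        Finset.sum_le_sum fun v _ => by split_ifs <;> norm_num
    _ = _ := by simp

/-- After a round, a tie at `v` requires that the new color of `v - 1` or of `v + 1` differs from the
old color of `v`. Conversely the new color of `u` differs from exactly one of the old colors of
`u - 1` and `u + 1` if there was a tie at `u`, and from neither otherwise. -/
theorem ties_update_le (c : Coloring (Fin (m + 3))) (r : Fin (m + 3) → Bool) :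
    ties (update (SimpleGraph.cycleGraph (m + 3)) c r) ≤ ties c := by
  set d := update (SimpleGraph.cycleGraph (m + 3)) c r with hd
  let δ : Bool → Bool → ℕ := fun a b => if a ≠ b then 1 else 0
  have hδ : ∀ e : Coloring (Fin (m + 3)), ties e = ∑ v, δ (e (v - 1)) (e (v + 1)) :=
    fun e => Finset.card_filter _ _
  rw [hδ, hδ]
  calc ∑ v, δ (d (v - 1)) (d (v + 1))
      ≤ ∑ v, (δ (d (v - 1)) (c v) + δ (c v) (d (v + 1))) := by
        refine Finset.sum_le_sum fun v _ => ?_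
        simp only [δ]
        cases d (v - 1) <;> cases d (v + 1) <;> cases c v <;> simp
    _ = ∑ v, δ (d v) (c (v + 1)) + ∑ v, δ (c (v - 1)) (d v) := by
        rw [Finset.sum_add_distrib]
        congr 1
        · rw [← Equiv.sum_comp (Equiv.addRight (1 : Fin (m + 3)))]
          simp
        · rw [← Equiv.sum_comp (Equiv.subRight (1 : Fin (m + 3)))]
          simp
    _ = ∑ v, δ (c (v - 1)) (c (v + 1)) := by
        rw [← Finset.sum_add_distrib]
        refine Finset.sum_congr rfl fun v _ => ?_
        rw [hd, update_cycleGraph]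
        simp only [δ]
        cases c (v - 1) <;> cases c (v + 1) <;> cases r v <;> simp

theorem ties_process_le (c₀ : Coloring (Fin (m + 3))) (ω : ℕ → Fin (m + 3) → Bool) (t : ℕ) :
    ties (process (SimpleGraph.cycleGraph (m + 3)) c₀ ω t) ≤ ties c₀ := by
  induction t with
  | zero => exact le_rfl
  | succ t ih => exact (ties_update_le _ _).trans ih

open Fin.NatCast in
/-- Without ties every other node has the same color, so at least one of any two consecutive nodes
is white as soon as there is a white node at all. -/
theorem whites_eq_zero_or_of_ties_eq_zero {c : Coloring (Fin (m + 3))} (h : ties c = 0) :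
    whites c = 0 ∨ ((m + 3 : ℕ) : ℝ) ≤ 2 * whites c := by
  rw [ties_eq_zero_iff] at h
  by_cases hw : ∃ u, c u = false
  · right
    obtain ⟨u, hu⟩ := hw
    have key : ∀ k : ℕ, c (u + k) = false ∨ c (u + k + 1) = false := by
      intro k
      induction k with
      | zero => left; simpa using hu
      | succ k ih =>
        have h1 := h (u + k + 1)
        rw [add_sub_cancel_right] at h1
        push_cast
        rw [← add_assoc, ← h1]
        exact ih.symm
    have key' : ∀ v, c v = false ∨ c (v + 1) = false := by
      intro v
      have := key (v - u).val
      rwa [Fin.cast_val_eq_self, add_sub_cancel] at this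
    have hs : whites c = ∑ v, if c (v + 1) then (0 : ℝ) else 1 := by
      rw [whites, ← Equiv.sum_comp (Equiv.addRight (1 : Fin (m + 3)))]
      rfl
    calc ((m + 3 : ℕ) : ℝ) = ∑ _v : Fin (m + 3), (1 : ℝ) := by simp
      _ ≤ ∑ v, ((if c v then (0 : ℝ) else 1) + if c (v + 1) then (0 : ℝ) else 1) := by
        refine Finset.sum_le_sum fun v _ => ?_
        rcases key' v with h' | h' <;> rw [h'] <;> split_ifs <;> norm_num at *
      _ = whites c + whites c := by rw [Finset.sum_add_distrib]; nth_rw 2 [hs]; rfl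
      _ = 2 * whites c := by ring
  · left
    push Not at hw
    exact Finset.sum_eq_zero fun v _ => by simp [hw v]

end Cycle

/-! ### Mean and variance of one round -/

section OneRound

theorem integral_coin (f : Bool → ℝ) : ∫ b, f b ∂coin = (f true + f false) / 2 := by
  rw [coin, PMF.integral_eq_sum]
  simp
  ring

variable {m : ℕ}

/-- In one round the number of white nodes has mean zero increments, and every tie contributes `1/4`
to their variance, as distinct nodes have independent coins. -/
theorem integral_sq_whites_update (c : Coloring (Fin (m + 3))) (a : ℝ) :
    ∫ r, (whites (update (SimpleGraph.cycleGraph (m + 3)) c r) - a) ^ 2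
      ∂(roundCoins (Fin (m + 3))) = (whites c - a) ^ 2 + ties c / 4 := by
  let w : Bool → ℝ := fun b => if b then 0 else 1
  let X : Fin (m + 3) → Bool → ℝ := fun v b =>
    w (if c (v - 1) = c (v + 1) then c (v + 1) else b)
  have hX : ∀ r, whites (update (SimpleGraph.cycleGraph (m + 3)) c r) =
      (∑ v, fun r : Fin (m + 3) → Bool => X v (r v)) r := by
    intro r
    simp only [whites, Finset.sum_apply, X, w, update_cycleGraph]
  have hmean : ∀ v, ∫ b, X v b ∂coin = (w (c (v - 1)) + w (c (v + 1))) / 2 := by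
    intro v
    rw [integral_coin]
    simp only [X, w]
    cases c (v - 1) <;> cases c (v + 1) <;> norm_num
  have hvar : ∀ v, ProbabilityTheory.variance (X v) coin =
      (if c (v - 1) ≠ c (v + 1) then 1 else 0) / 4 := by
    intro v
    rw [ProbabilityTheory.variance_eq_integral (measurable_of_finite _).aemeasurable,
      hmean, integral_coin]
    simp only [X, w]
    cases c (v - 1) <;> cases c (v + 1) <;> norm_num
  set Y : (Fin (m + 3) → Bool) → ℝ := ∑ v, fun r => X v (r v) with hY
  have hYvar : ProbabilityTheory.variance Y (roundCoins (Fin (m + 3))) = ties c / 4 := by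
    rw [hY, roundCoins, ProbabilityTheory.variance_sum_pi (fun v => MemLp.of_discrete)]
    simp_rw [hvar]
    rw [← Finset.sum_div, ties, Finset.card_filter]
    push_cast
    rfl
  have hYmean : ∫ r, Y r ∂(roundCoins (Fin (m + 3))) = whites c := by
    simp only [hY, Finset.sum_apply]
    rw [integral_finsetSum _ fun v _ => Integrable.of_finite]
    have : ∀ v : Fin (m + 3), ∫ r, X v (r v) ∂(roundCoins (Fin (m + 3))) = ∫ b, X v b ∂coin := by
      intro v
      exact integral_comp_eval (μ := fun _ : Fin (m + 3) => coin)
        (measurable_of_finite _).aestronglyMeasurable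
    simp_rw [this, hmean]
    rw [← Finset.sum_div, Finset.sum_add_distrib,
      ← Equiv.sum_comp (Equiv.addRight (1 : Fin (m + 3))) (fun v => w (c (v - 1))),
      ← Equiv.sum_comp (Equiv.subRight (1 : Fin (m + 3))) (fun v => w (c (v + 1)))]
    simp only [Equiv.coe_addRight, Equiv.subRight_apply, add_sub_cancel_right, sub_add_cancel]
    rw [add_self_div_two]
    rfl
  simp_rw [hX]
  rw [ProbabilityTheory.variance_eq_sub MemLp.of_discrete, hYmean] at hYvar
  have h2 : ∀ r, (Y r - a) ^ 2 = (Y ^ 2) r + (-2 * a) * Y r + a ^ 2 := by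
    intro r; simp only [Pi.pow_apply]; ring
  simp_rw [h2]
  rw [integral_add Integrable.of_finite Integrable.of_finite,
    integral_add Integrable.of_finite Integrable.of_finite, integral_const_mul, hYmean]
  simp only [integral_const, probReal_univ, one_smul]
  linarith

end OneRound

/-! ### Markov property -/

section Markov

variable {V : Type*} [Fintype V] (G : SimpleGraph V) [DecidableRel G.Adj]

/-- The coloring in round `t` depends on the coins of the first `t` rounds only. -/
theorem process_congr (c₀ : Coloring V) {ω ω' : ℕ → V → Bool} {t : ℕ}
    (h : ∀ i < t, ω i = ω' i) : process G c₀ ω t = process G c₀ ω' t := by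
  induction t with
  | zero => rfl
  | succ t ih =>
    simp only [process]
    rw [ih fun i hi => h i (hi.trans t.lt_succ_self), h t t.lt_succ_self]

theorem measurable_process (c₀ : Coloring V) (t : ℕ) :
    Measurable fun ω => process G c₀ ω t := by
  induction t with
  | zero => exact measurable_const
  | succ t ih =>
    exact (measurable_of_finite (fun p : Coloring V × (V → Bool) => update G p.1 p.2)).comp
      (ih.prodMk (measurable_pi_apply t))

instance : IsProbabilityMeasure (coins V) :=
  inferInstanceAs (IsProbabilityMeasure (Measure.infinitePi fun _ => roundCoins V))

theorem integrable_process (c₀ : Coloring V) (t : ℕ) (f : Coloring V → ℝ) :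
    Integrable (fun ω => f (process G c₀ ω t)) (coins V) :=
  (Integrable.of_finite (f := f)).comp_measurable (measurable_process G c₀ t)

/-- The Markov property: the coins of round `t + 1` are fresh, so the coloring in that round is
distributed as one round started from the coloring in round `t`. -/
theorem integral_process_succ (c₀ : Coloring V) (t : ℕ) (f : Coloring V → ℝ) :
    ∫ ω, f (process G c₀ ω (t + 1)) ∂(coins V) =
      ∫ ω, (∫ r, f (update G (process G c₀ ω t) r) ∂(roundCoins V)) ∂(coins V) := by
  have hind : ProbabilityTheory.IndepFun (fun ω : ℕ → V → Bool => process G c₀ ω t)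
      (fun ω => ω t) (coins V) := by
    have h := (ProbabilityTheory.iIndepFun_infinitePi (P := fun _ : ℕ => roundCoins V)
      (X := fun _ x => x) (fun _ => measurable_id)).indepFun_finset (Finset.range t) {t}
      (by simp) (fun i => measurable_pi_apply i)
    -- A round-`t` coloring computed from the first `t` rounds of coins, padded arbitrarily.
    let g : ((i : Finset.range t) → V → Bool) → Coloring V := fun x =>
      process G c₀ (fun i => if hi : i ∈ Finset.range t then x ⟨i, hi⟩ else fun _ => true) t
    let e : (({t} : Finset ℕ) → V → Bool) → V → Bool := fun x => x ⟨t, by simp⟩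
    have h' := h.comp (φ := g) (ψ := e) (measurable_of_finite _) (measurable_of_finite _)
    refine h'.congr (Filter.Eventually.of_forall fun ω => ?_)
      (Filter.Eventually.of_forall fun ω => rfl)
    exact process_congr G c₀ fun i hi => by simp [hi]
  have hmap := (ProbabilityTheory.indepFun_iff_map_prod_eq_prod_map_map
    (measurable_process G c₀ t).aemeasurable (measurable_pi_apply t).aemeasurable).1 hind
  have ht : (coins V).map (fun ω => ω t) = roundCoins V :=
    Measure.infinitePi_map_eval (fun _ => roundCoins V) t
  rw [ht] at hmap
  have : IsProbabilityMeasure ((coins V).map fun ω => process G c₀ ω t) :=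
    Measure.isProbabilityMeasure_map (measurable_process G c₀ t).aemeasurable
  calc ∫ ω, f (process G c₀ ω (t + 1)) ∂(coins V)
      = ∫ p : Coloring V × (V → Bool), f (update G p.1 p.2)
          ∂((coins V).map fun ω => (process G c₀ ω t, ω t)) := by
        rw [integral_map ((measurable_process G c₀ t).prodMk (measurable_pi_apply t)).aemeasurable
          (measurable_of_finite _).aestronglyMeasurable]
        rfl
    _ = ∫ c, (∫ r, f (update G c r) ∂(roundCoins V))
          ∂((coins V).map fun ω => process G c₀ ω t) := by
        rw [hmap, integral_prod _ Integrable.of_finite]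
    _ = _ := integral_map (measurable_process G c₀ t).aemeasurable
        (measurable_of_finite _).aestronglyMeasurable

/-- Every outcome of the coins of a round has positive probability. -/
theorem edge_iff {s s' : Coloring V} : Edge G s s' ↔ ∃ r, update G s r = s' := by
  constructor
  · intro h
    by_contra! hne
    exact h (by simp [transProb, hne])
  · rintro ⟨r, hr⟩ h0
    have h1 : roundCoins V {r} = 0 := measure_mono_null (by simpa using hr) h0
    rw [roundCoins, Measure.pi_singleton, Finset.prod_eq_zero_iff] at h1
    obtain ⟨v, -, hv⟩ := h1
    rw [coin, PMF.toMeasure_apply_singleton _ _ (measurableSet_singleton _)] at hv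
    simp at hv

end Markov

/-! ### Absorption time -/

section Absorption

variable {V : Type*} [Fintype V] (G : SimpleGraph V) [DecidableRel G.Adj]

/-- A coloring that belongs to an absorbing component. -/
def IsAbsorbed (c : Coloring V) : Prop := ∃ S, IsAbsorbingComponent G S ∧ c ∈ S

open Classical in
theorem absorptionTime_le_tsum (c₀ : Coloring V) (ω : ℕ → V → Bool) :
    absorptionTime G c₀ ω ≤ ∑' t, if IsAbsorbed G (process G c₀ ω t) then 0 else 1 := by
  by_cases h : ∃ t, IsAbsorbed G (process G c₀ ω t)
  · calc absorptionTime G c₀ ω ≤ (Nat.find h : ℝ≥0∞) := iInf₂_le (Nat.find h) (Nat.find_spec h)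
      _ = ∑ t ∈ Finset.range (Nat.find h),
            if IsAbsorbed G (process G c₀ ω t) then (0 : ℝ≥0∞) else 1 := by
          rw [Finset.sum_congr rfl fun t ht =>
            if_neg (Nat.find_min h (Finset.mem_range.1 ht))]
          simp
      _ ≤ _ := ENNReal.sum_le_tsum _
  · push Not at h
    simp [h]

theorem IsAbsorbed.update {c : Coloring V} (h : IsAbsorbed G c) (r : V → Bool) :
    IsAbsorbed G (update G c r) := by
  obtain ⟨S, hS, hc⟩ := h
  exact ⟨S, hS, hS.2 c hc _ ((edge_iff G).2 ⟨r, rfl⟩)⟩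

theorem IsAbsorbed.process_of_le {c₀ : Coloring V} {ω : ℕ → V → Bool} {s t : ℕ} (hst : s ≤ t)
    (h : IsAbsorbed G (process G c₀ ω s)) : IsAbsorbed G (process G c₀ ω t) := by
  induction t, hst using Nat.le_induction with
  | base => exact h
  | succ t _ ih => exact ih.update G (ω t)

theorem le_absorptionTime {c₀ : Coloring V} {ω : ℕ → V → Bool} {t : ℕ}
    (h : ¬ IsAbsorbed G (process G c₀ ω t)) : (t : ℝ≥0∞) ≤ absorptionTime G c₀ ω := by
  refine le_iInf₂ fun s hs => ?_
  by_contra! hlt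
  exact h (IsAbsorbed.process_of_le G (by exact_mod_cast hlt.le) hs)

theorem measurableSet_process (c₀ : Coloring V) (t : ℕ) (A : Set (Coloring V)) :
    MeasurableSet {ω | process G c₀ ω t ∈ A} :=
  measurable_process G c₀ t (Set.toFinite A).measurableSet

/-- The expected absorption time is at most the expected number of rounds in which the process is
not absorbed. -/
theorem stabilizationTime_le_tsum (c₀ : Coloring V) :
    stabilizationTime G c₀ ≤ ∑' t, coins V {ω | ¬ IsAbsorbed G (process G c₀ ω t)} := by
  classical
  have hm : ∀ t, MeasurableSet {ω | ¬ IsAbsorbed G (process G c₀ ω t)} := fun t =>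
    measurableSet_process G c₀ t {c | ¬ IsAbsorbed G c}
  calc stabilizationTime G c₀
      ≤ ∫⁻ ω, ∑' t, {ω | ¬ IsAbsorbed G (process G c₀ ω t)}.indicator 1 ω ∂(coins V) := by
        refine lintegral_mono fun ω => (absorptionTime_le_tsum G c₀ ω).trans_eq ?_
        refine tsum_congr fun t => ?_
        by_cases h : IsAbsorbed G (process G c₀ ω t) <;> simp [h]
    _ = _ := by
        rw [lintegral_tsum fun t => (measurable_one.indicator (hm t)).aemeasurable]
        exact tsum_congr fun t => lintegral_indicator_one (hm t)

theorem mul_measure_le_stabilizationTime (c₀ : Coloring V) (t : ℕ) :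
    t * coins V {ω | ¬ IsAbsorbed G (process G c₀ ω t)} ≤ stabilizationTime G c₀ := by
  have hm : MeasurableSet {ω | ¬ IsAbsorbed G (process G c₀ ω t)} :=
    measurableSet_process G c₀ t {c | ¬ IsAbsorbed G c}
  rw [← lintegral_indicator_const hm]
  refine lintegral_mono fun ω => ?_
  by_cases h : IsAbsorbed G (process G c₀ ω t)
  · simp [h]
  · simpa [h] using le_absorptionTime G h

end Absorption

/-! ### Absorbing components of the cycle -/

section AbsorbedCycle

variable {m : ℕ}

/-- Without ties a round merely rotates the coloring, and two rounds restore it; so the coloring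
and its rotation form an absorbing component. -/
theorem isAbsorbed_of_ties_eq_zero {c : Coloring (Fin (m + 3))} (h : ties c = 0) :
    IsAbsorbed (SimpleGraph.cycleGraph (m + 3)) c := by
  rw [ties_eq_zero_iff] at h
  let d : Coloring (Fin (m + 3)) := fun v => c (v + 1)
  have hc : ∀ s', Edge (SimpleGraph.cycleGraph (m + 3)) c s' ↔ s' = d := by
    have : ∀ r, update (SimpleGraph.cycleGraph (m + 3)) c r = d := fun r => by
      ext v; rw [update_cycleGraph, if_pos (h v)]
    simp [edge_iff, this, eq_comm]
  have hd : ∀ s', Edge (SimpleGraph.cycleGraph (m + 3)) d s' ↔ s' = c := by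
    have : ∀ r, update (SimpleGraph.cycleGraph (m + 3)) d r = c := fun r => by
      ext v
      have h1 := h (v + 1)
      rw [add_sub_cancel_right] at h1
      rw [update_cycleGraph]
      simp only [d, sub_add_cancel]
      rw [if_pos h1, h1]
    simp [edge_iff, this, eq_comm]
  have hcd : Reachable (SimpleGraph.cycleGraph (m + 3)) c d := .single ((hc d).2 rfl)
  have hdc : Reachable (SimpleGraph.cycleGraph (m + 3)) d c := .single ((hd c).2 rfl)
  have hcomp : ∀ x, Reachable (SimpleGraph.cycleGraph (m + 3)) c x → x = c ∨ x = d := by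
    intro x hx
    induction hx with
    | refl => exact .inl rfl
    | tail _ hy ih =>
      rcases ih with rfl | rfl
      · exact .inr ((hc _).1 hy)
      · exact .inl ((hd _).1 hy)
  refine ⟨_, ⟨⟨c, rfl⟩, fun x hx x' hx' => ?_⟩, ⟨.refl, .refl⟩⟩
  have hcx' : Reachable (SimpleGraph.cycleGraph (m + 3)) c x' := hx.1.tail hx'
  refine ⟨hcx', ?_⟩
  rcases hcomp x' hcx' with rfl | rfl
  · exact .refl
  · exact hdc

/-- In an absorbing component, take a coloring that maximizes the square of the number of white
nodes. A tie would increase the mean of this square in the next round, without leaving the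
component; and the other colorings of the component are reached from this one. -/
theorem IsAbsorbed.ties_eq_zero {c : Coloring (Fin (m + 3))}
    (h : IsAbsorbed (SimpleGraph.cycleGraph (m + 3)) c) : ties c = 0 := by
  obtain ⟨S, ⟨⟨s₀, rfl⟩, hclosed⟩, hc⟩ := h
  obtain ⟨s, hs, hmax⟩ := (Set.toFinite
    (component (SimpleGraph.cycleGraph (m + 3)) s₀)).exists_maximalFor
    (fun s => (whites s - 0) ^ 2) _ ⟨c, hc⟩
  have hle : ∀ r, (whites (RMM.update (SimpleGraph.cycleGraph (m + 3)) s r) - 0) ^ 2 ≤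
      (whites s - 0) ^ 2 := by
    intro r
    rcases le_total ((whites (RMM.update (SimpleGraph.cycleGraph (m + 3)) s r) - 0) ^ 2)
      ((whites s - 0) ^ 2) with h | h
    · exact h
    · exact hmax (hclosed s hs _ ((edge_iff _).2 ⟨r, rfl⟩)) h
  have hint := integral_sq_whites_update s 0
  have hmono : ∫ r, (whites (RMM.update (SimpleGraph.cycleGraph (m + 3)) s r) - 0) ^ 2
      ∂(roundCoins (Fin (m + 3))) ≤ ∫ _r, (whites s - 0) ^ 2 ∂(roundCoins (Fin (m + 3))) :=
    integral_mono Integrable.of_finite Integrable.of_finite hle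
  rw [hint, integral_const, probReal_univ, one_smul] at hmono
  have hzero : ties s = 0 := by
    have h1 : (ties s : ℝ) ≤ 0 := by linarith
    exact_mod_cast h1.antisymm (Nat.cast_nonneg _)
  have hreach : Reachable (SimpleGraph.cycleGraph (m + 3)) s c := hs.2.trans hc.1
  clear hint hmono hle hmax hc
  induction hreach with
  | refl => exact hzero
  | tail _ hy ih =>
    obtain ⟨r, rfl⟩ := (edge_iff _).1 hy
    exact Nat.eq_zero_of_le_zero (ih ▸ ties_update_le _ r)

end AbsorbedCycle

/-! ### Quadratic bounds -/

section Bounds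

variable {m : ℕ}

theorem integral_sq_whites_process_succ (c₀ : Coloring (Fin (m + 3))) (a : ℝ) (t : ℕ) :
    ∫ ω, (whites (process (SimpleGraph.cycleGraph (m + 3)) c₀ ω (t + 1)) - a) ^ 2
        ∂(coins (Fin (m + 3))) =
      ∫ ω, (whites (process (SimpleGraph.cycleGraph (m + 3)) c₀ ω t) - a) ^ 2
        ∂(coins (Fin (m + 3))) +
      (∫ ω, (ties (process (SimpleGraph.cycleGraph (m + 3)) c₀ ω t) : ℝ)
        ∂(coins (Fin (m + 3)))) / 4 := by
  rw [integral_process_succ _ _ _ fun c => (whites c - a) ^ 2]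
  simp_rw [integral_sq_whites_update]
  rw [integral_add (integrable_process _ _ _ fun c => (whites c - a) ^ 2)
    (integrable_process _ _ _ fun c => (ties c : ℝ) / 4), integral_div]

/-- Every round before absorption has a tie, so the mean square of the number of white nodes
accounts for the expected number of these rounds. -/
theorem sum_measure_not_isAbsorbed_le (c₀ : Coloring (Fin (m + 3))) (N : ℕ) :
    (∑ t ∈ Finset.range N, (coins (Fin (m + 3))).real
      {ω | ¬ IsAbsorbed (SimpleGraph.cycleGraph (m + 3))
        (process (SimpleGraph.cycleGraph (m + 3)) c₀ ω t)}) / 4 ≤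
      ∫ ω, (whites (process (SimpleGraph.cycleGraph (m + 3)) c₀ ω N) - 0) ^ 2
        ∂(coins (Fin (m + 3))) := by
  induction N with
  | zero =>
    simp only [Finset.range_zero, Finset.sum_empty, zero_div]
    exact integral_nonneg fun ω => sq_nonneg _
  | succ N ih =>
    rw [Finset.sum_range_succ, integral_sq_whites_process_succ, add_div]
    refine add_le_add ih (div_le_div_of_nonneg_right ?_ (by norm_num))
    have hm := measurableSet_process (SimpleGraph.cycleGraph (m + 3)) c₀ N
      {c | ¬ IsAbsorbed (SimpleGraph.cycleGraph (m + 3)) c}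
    refine (integral_indicator_one hm).symm.trans_le (integral_mono
      ((integrable_const 1).indicator hm)
      (integrable_process _ _ _ fun c => (ties c : ℝ)) fun ω => ?_)
    by_cases h : IsAbsorbed (SimpleGraph.cycleGraph (m + 3))
        (process (SimpleGraph.cycleGraph (m + 3)) c₀ ω N)
    · simp [h]
    · have h1 : 1 ≤ ties (process (SimpleGraph.cycleGraph (m + 3)) c₀ ω N) :=
        Nat.one_le_iff_ne_zero.2 fun h0 => h (isAbsorbed_of_ties_eq_zero h0)
      simpa [h] using h1

theorem stabilizationTime_cycleGraph_le (c₀ : Coloring (Fin (m + 3))) :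
    stabilizationTime (SimpleGraph.cycleGraph (m + 3)) c₀ ≤
      (4 : ℝ≥0) * ((m + 3 : ℕ) : ℝ≥0∞) ^ 2 := by
  refine (stabilizationTime_le_tsum _ c₀).trans ?_
  rw [ENNReal.tsum_eq_iSup_nat]
  refine iSup_le fun N => ?_
  have hbound : ∫ ω, (whites (process (SimpleGraph.cycleGraph (m + 3)) c₀ ω N) - 0) ^ 2
      ∂(coins (Fin (m + 3))) ≤ ∫ _ω, ((m + 3 : ℕ) : ℝ) ^ 2 ∂(coins (Fin (m + 3))) := by
    refine integral_mono (integrable_process _ _ _ fun c => (whites c - 0) ^ 2)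
      (integrable_const _) fun ω => ?_
    simp only [sub_zero]
    exact pow_le_pow_left₀ (whites_nonneg _) (whites_le _) 2
  rw [integral_const, probReal_univ, one_smul] at hbound
  have h := (sum_measure_not_isAbsorbed_le c₀ N).trans hbound
  rw [div_le_iff₀ (by norm_num), mul_comm] at h
  have h' := ENNReal.ofReal_le_ofReal h
  rw [ENNReal.ofReal_sum_of_nonneg fun _ _ => measureReal_nonneg] at h'
  refine le_trans (Finset.sum_le_sum fun t _ => (ofReal_measureReal (measure_ne_top _ _)).ge)
    (h'.trans_eq ?_)
  rw [ENNReal.ofReal_mul (by norm_num), ENNReal.ofReal_pow (by positivity), ENNReal.ofReal_natCast]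
  simp

theorem integral_sq_whites_process_le {c₀ : Coloring (Fin (m + 3))} {k : ℕ} (hk : ties c₀ ≤ k)
    (a : ℝ) (t : ℕ) :
    ∫ ω, (whites (process (SimpleGraph.cycleGraph (m + 3)) c₀ ω t) - a) ^ 2
        ∂(coins (Fin (m + 3))) ≤ (whites c₀ - a) ^ 2 + t * (k / 4) := by
  induction t with
  | zero => simp [process]
  | succ t ih =>
    rw [integral_sq_whites_process_succ]
    have : ∫ ω, (ties (process (SimpleGraph.cycleGraph (m + 3)) c₀ ω t) : ℝ)
        ∂(coins (Fin (m + 3))) ≤ ∫ _ω, (k : ℝ) ∂(coins (Fin (m + 3))) :=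
      integral_mono (integrable_process _ _ _ fun c => (ties c : ℝ)) (integrable_const _)
        fun ω => Nat.cast_le.2 ((ties_process_le c₀ ω t).trans hk)
    rw [integral_const, probReal_univ, one_smul] at this
    push_cast
    linarith

/-- With at most two ties, the number of white nodes moves by less than its initial value `a` within
`a ^ 2` rounds with probability at least `1 / 2`. If `4 * a ≤ n`, such a move cannot lead to
absorption, where the number of white nodes is zero or at least half of the cycle. -/
theorem sq_le_stabilizationTime {c₀ : Coloring (Fin (m + 3))} (h : ties c₀ ≤ 2) {a : ℕ}
    (ha : whites c₀ = a) (hpos : 0 < a) (hle : 4 * a ≤ m + 3) :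
    (1 / 2 : ℝ≥0) * (a : ℝ≥0∞) ^ 2 ≤
      stabilizationTime (SimpleGraph.cycleGraph (m + 3)) c₀ := by
  set A := {ω | IsAbsorbed (SimpleGraph.cycleGraph (m + 3))
    (process (SimpleGraph.cycleGraph (m + 3)) c₀ ω (a ^ 2))} with hA
  have hmA : MeasurableSet A := measurableSet_process (SimpleGraph.cycleGraph (m + 3)) c₀ (a ^ 2)
    {c | IsAbsorbed (SimpleGraph.cycleGraph (m + 3)) c}
  have haR : (0 : ℝ) < a := by exact_mod_cast hpos
  have hleR : 4 * (a : ℝ) ≤ (m + 3 : ℕ) := by exact_mod_cast hle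
  have hA2 : (coins (Fin (m + 3))).real A ≤ 1 / 2 := by
    have hint := integral_sq_whites_process_le h a (a ^ 2)
    rw [ha, sub_self] at hint
    have hcheb := mul_meas_ge_le_integral_of_nonneg (μ := coins (Fin (m + 3)))
      (Filter.Eventually.of_forall fun ω => sq_nonneg
        (whites (process (SimpleGraph.cycleGraph (m + 3)) c₀ ω (a ^ 2)) - a))
      (integrable_process _ c₀ (a ^ 2) fun c => (whites c - a) ^ 2) ((a : ℝ) ^ 2)
    have hsub : A ⊆ {ω | (a : ℝ) ^ 2 ≤
        (whites (process (SimpleGraph.cycleGraph (m + 3)) c₀ ω (a ^ 2)) - a) ^ 2} := by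
      intro ω hω
      simp only [Set.mem_ofPred_eq]
      rcases whites_eq_zero_or_of_ties_eq_zero (IsAbsorbed.ties_eq_zero hω) with h0 | h0
      · rw [h0, zero_sub, neg_sq]
      · exact pow_le_pow_left₀ haR.le (by linarith) 2
    have hmul := mul_le_mul_of_nonneg_left (measureReal_mono (μ := coins (Fin (m + 3))) hsub)
      (sq_nonneg (a : ℝ))
    have h1 := (hmul.trans hcheb).trans hint
    push_cast at h1
    nlinarith [pow_pos haR 2]
  have hAc : (1 / 2 : ℝ≥0) ≤ coins (Fin (m + 3)) Aᶜ := by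
    rw [← ofReal_measureReal, probReal_compl_eq_one_sub hmA, ENNReal.ofReal]
    refine ENNReal.coe_le_coe.2 (NNReal.coe_le_coe.1 ?_)
    rw [Real.coe_toNNReal _ (by linarith)]
    push_cast
    linarith
  refine le_trans ?_ (mul_measure_le_stabilizationTime _ c₀ (a ^ 2))
  rw [mul_comm, Nat.cast_pow]
  exact mul_le_mul_right hAc _

end Bounds

/-! ### Alternating colorings -/

section Alternating

variable {m : ℕ}

/-- Relative to its start, the alternating path of `2 * j + 1` nodes is cut off from the blue rest by
ties at the positions `-1` and `2 * j + 1` only. -/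
theorem ties_alternatingColoring_le {j : ℕ} (hj : 2 * j + 2 < m + 3) (s : Fin (m + 3)) :
    ties (alternatingColoring (m + 3) (2 * j + 1) s) ≤ 2 := by
  have hsub : (Finset.univ.filter fun v =>
      alternatingColoring (m + 3) (2 * j + 1) s (v - 1) ≠
        alternatingColoring (m + 3) (2 * j + 1) s (v + 1)) ⊆
      {s + Fin.last _, s + ⟨2 * j + 1, by omega⟩} := by
    intro v hv
    rw [Finset.mem_filter] at hv
    obtain ⟨u, rfl⟩ : ∃ u, v = s + u := ⟨v - s, by abel⟩
    have h1 : s + u - 1 - s = u - 1 := by abel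
    have h2 : s + u + 1 - s = u + 1 := by abel
    simp only [Finset.mem_insert, Finset.mem_singleton, add_right_inj]
    by_contra! hu
    apply hv.2
    simp only [alternatingColoring, h1, h2]
    have hlast : u.val ≠ m + 2 := fun h => hu.1 (Fin.ext h)
    have hend : u.val ≠ 2 * j + 1 := fun h => hu.2 (Fin.ext h)
    have hult := u.isLt
    have hplus : (u + 1).val = u.val + 1 := by
      rw [Fin.val_add]
      simp
      omega
    have hminus : (u - 1).val = if u.val = 0 then m + 2 else u.val - 1 := by
      split_ifs with h0
      · have : u = 0 := Fin.ext h0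
        rw [this]
        simp
      · rw [Fin.val_sub_one_of_ne_zero]
        intro h; exact h0 (by rw [h]; rfl)
    rw [hplus, hminus]
    congr 2
    rw [eq_iff_iff]
    simp only [Nat.even_iff]
    split_ifs <;> omega
  exact (Finset.card_le_card hsub).trans Finset.card_le_two

theorem whites_alternatingColoring {j : ℕ} (hj : 2 * j + 1 ≤ m + 3) (s : Fin (m + 3)) :
    whites (alternatingColoring (m + 3) (2 * j + 1) s) = (j + 1 : ℕ) := by
  have h1 : whites (alternatingColoring (m + 3) (2 * j + 1) s) =
      ∑ u : Fin (m + 3), if u.val < 2 * j + 1 ∧ Even u.val then (1 : ℝ) else 0 := by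
    rw [whites, ← Equiv.sum_comp (Equiv.addRight s)]
    refine Finset.sum_congr rfl fun u _ => ?_
    simp only [alternatingColoring, Equiv.coe_addRight, add_sub_cancel_right]
    by_cases h : u.val < 2 * j + 1 ∧ Even u.val
    · rw [if_pos h, if_neg (by simp only [decide_eq_true h, Bool.not_true]; decide)]
    · rw [if_neg h, if_pos (by simp only [decide_eq_false h, Bool.not_false])]
  rw [h1, Finset.sum_boole]
  congr 1
  rw [← Finset.card_range (j + 1)]
  refine (Finset.card_nbij' (fun i => Fin.ofNat (m + 3) (2 * i)) (fun u => u.val / 2)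
    ?_ ?_ ?_ ?_).symm
  · intro i hi
    simp only [Finset.coe_range, Set.mem_Iio] at hi
    have : 2 * i % (m + 3) = 2 * i := Nat.mod_eq_of_lt (by omega)
    simp [this]
    omega
  · intro u hu
    simp at hu
    simp
    omega
  · intro i hi
    simp only [Finset.coe_range, Set.mem_Iio] at hi
    have : 2 * i % (m + 3) = 2 * i := Nat.mod_eq_of_lt (by omega)
    simp [this]
  · intro u hu
    simp only [Finset.coe_filter, Finset.mem_univ, true_and, Set.mem_ofPred_eq, Nat.even_iff] at hu
    apply Fin.ext
    have : 2 * (u.val / 2) = u.val := by omega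
    simp [this]

end Alternating

end RMM

/-! ### Stabilization time on the cycle -/

theorem mainTheorem2 :
    (∃ C : ℝ≥0, ∀ n : ℕ, 3 ≤ n → ∀ c₀ : RMM.Coloring (Fin n),
      RMM.stabilizationTime (SimpleGraph.cycleGraph n) c₀ ≤ C * (n : ℝ≥0∞) ^ 2) ∧
    (∃ c : ℝ≥0, 0 < c ∧ ∀ᶠ n : ℕ in Filter.atTop, ∀ s : Fin n,
      c * (n : ℝ≥0∞) ^ 2 ≤
        RMM.stabilizationTime (SimpleGraph.cycleGraph n)
          (RMM.alternatingColoring n (RMM.halfLength n) s)) := by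
  refine ⟨⟨4, fun n hn c₀ => ?_⟩, ⟨1 / 128, by norm_num, ?_⟩⟩
  · obtain ⟨m, rfl⟩ := Nat.exists_eq_add_of_le' hn
    exact RMM.stabilizationTime_cycleGraph_le c₀
  · filter_upwards [Filter.eventually_ge_atTop 8] with n hn s
    obtain ⟨m, rfl⟩ := Nat.exists_eq_add_of_le' (show 3 ≤ n by omega)
    have hl : RMM.maxLength (m + 3) ≤ m + 3 - 4 ∧ m + 3 - 5 ≤ RMM.maxLength (m + 3) := by
      unfold RMM.maxLength
      split_ifs <;> omega
    set j := RMM.maxLength (m + 3) / 4 with hj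
    -- The number `j + 1` of white nodes lies between `n / 8` and `n / 4`.
    have hn8 : m + 3 ≤ 8 * (j + 1) := by omega
    refine le_trans ?_ (RMM.sq_le_stabilizationTime
      (RMM.ties_alternatingColoring_le (j := j) (by omega) s)
      (RMM.whites_alternatingColoring (by omega) s) j.succ_pos (by omega))
    have h1 : ((m + 3 : ℕ) : ℝ≥0) ≤ 8 * ((j + 1 : ℕ) : ℝ≥0) := by exact_mod_cast hn8
    have h2 : (1 / 128 : ℝ≥0) * ((m + 3 : ℕ) : ℝ≥0) ^ 2 ≤
        (1 / 2 : ℝ≥0) * ((j + 1 : ℕ) : ℝ≥0) ^ 2 := by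
      calc (1 / 128 : ℝ≥0) * ((m + 3 : ℕ) : ℝ≥0) ^ 2
          ≤ (1 / 128 : ℝ≥0) * (8 * ((j + 1 : ℕ) : ℝ≥0)) ^ 2 := by gcongr
        _ = _ := by ring
    exact_mod_cast ENNReal.coe_le_coe.2 h2
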